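/- Fix integers $N,K\ge 0$, real numbers $g,g',Y$ and a real polynomial $V$ in $4N+K$ real variables. For $d\ge 1$ let $\mathcal L_d$ be the NHDM+KS Lagrangian ($N$ Higgs doublets and $K$ real gauge singlets) in $d$ spacetime dimensions with Minkowski metric of signature $(+,-,\dots,-)$, \[ \mathcal L_d=\sum_{\mu=0}^{d-1}\Big(\sum_{n=1}^N (D_\mu\Phi_n)^\dagger D^\mu\Phi_n+\sum_{m=1}^K\tfrac12\,\partial_\mu s_m\,\partial^\mu s_m\Big)-V(\Phi,s)-\sum_{\mu,\nu=0}^{d-1}\Big(\tfrac14 W^a_{\mu\nu}W^{a\,\mu\nu}+\tfrac14 B_{\mu\nu}B^{\mu\nu}\Big), \] where $a\in\{1,2,3\}$ is summed over, $D_\mu=\partial_\mu+ig\frac{\sigma^a}{2}W^a_\mu+ig'YB_\mu$ with $\sigma^a$ the Pauli matrices, $W^a_{\mu\nu}=\partial_\mu W^a_\nu-\partial_\nu W^a_\mu+g\,\epsilon^{abc}W^b_\mu W^c_\nu$, $B_{\mu\nu}=\partial_\mu B_\nu-\partial_\nu B_\mu$ and $\Phi_j=\frac1{\sqrt2}(\phi_{4j-3}+i\phi_{4j-2},\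 \phi_{4j-1}+i\phi_{4j})^T$. Write $\phi=(\phi_1,\dots,\phi_{4N+K})$ with $\phi_{4N+k}=s_k$ for all the real scalar fields; $V$ is a polynomial in $\phi$. Let $U\subseteq\mathbb R^{4N+K}$ be open. A smooth map $\eta:U\to\mathbb R^{4N+K}$ defines, in every dimension $d$, the scalar generator $X=\sum_i\eta^i(\phi)\,\partial_{\phi_i}$, which transforms neither the spacetime variables $x^\mu$ nor the gauge fields. Let $\operatorname{pr}X$ be its prolongation to the derivatives of the fields. $X$ is a variational Lie point symmetry of $\mathcal L_d$ (over $U$) if $\operatorname{pr}X(\mathcal L_d)=\sum_\mu d_\mu\beta^\mu$ identically on the jets with $\phi\in U$, without use of the field equations, where $d_\mu$ is the total derivative and the $\beta^\mu$ are smooth local functions of $x$, the fields and finitely many of their derivatives. It is a strict variational symmetry if $\operatorname{pr}X(\mathcal L_d)=0$ there, and a divergence symmetry if it is variational but not strict. Then $\mathcal L_4$ and $\mathcal L_1$, formed with the same $N,K,g,g',Y,V$, have exactly the same scalar variational Lie point symmetries: for every $\eta$, the scalar generator of $\eta$ is a variational Lie point symmetry of $\mathcal L_4$ if and only if it is one of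 $\mathcal L_1$. The same holds for the strict variational symmetries and for the divergence symmetries. Hence, to find all scalar variational Lie point symmetries of $\mathcal L_4$, it suffices to find those of $\mathcal L_1$. -/

import Mathlib

open scoped ContDiff Matrix

noncomputable section

namespace NHDM

/-! Jets, total derivatives and prolongations, for `d` independent variables and real dependent
variables (fields) indexed by `ι`. -/

/-- Multi-indices `J = (j_0, …, j_{d-1})`. -/
abbrev MultiIndex (d : ℕ) : Type := Fin d → ℕ

/-- The norm `|J| = j_0 + ⋯ + j_{d-1}`. -/
def MultiIndex.order {d : ℕ} (J : MultiIndex d) : ℕ := ∑ μ, J μ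

/-- The finite set of multi-indices `J` with `|J| ≤ n`. -/
def lowOrder (d n : ℕ) : Finset (MultiIndex d) :=
  {J ∈ Fintype.piFinset (fun _ : Fin d => Finset.range (n + 1)) | J.order ≤ n}

theorem mem_lowOrder {d n : ℕ} (J : MultiIndex d) : J ∈ lowOrder d n ↔ J.order ≤ n := by
  simp only [lowOrder, Finset.mem_filter, Fintype.mem_piFinset, Finset.mem_range,
    and_iff_right_iff_imp]
  intro h μ
  exact Nat.lt_succ_of_le
    (le_trans (Finset.single_le_sum (f := J) (fun _ _ => Nat.zero_le _) (Finset.mem_univ μ)) h)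

theorem zero_mem_lowOrder (d n : ℕ) : (0 : MultiIndex d) ∈ lowOrder d n := by
  simp [mem_lowOrder, MultiIndex.order]

/-- The multi-index of a single derivative with respect to `x^μ`. -/
abbrev MultiIndex.single {d : ℕ} (μ : Fin d) : MultiIndex d := Pi.single μ 1

/-- The space of variables `(x, y)`. -/
abbrev Base (d : ℕ) (ι : Type*) : Type _ := (Fin d → ℝ) × (ι → ℝ)

/-- The infinite jet space, with formal coordinates `x^μ` (first component) and `y^i_J`
(second component). -/
abbrev Jet (d : ℕ) (ι : Type*) : Type _ := (Fin d → ℝ) × (ι → MultiIndex d → ℝ)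

/-- The jet space of order `n`, with coordinates `x^μ` and `y^i_J`, `|J| ≤ n`. -/
abbrev FiniteJet (d : ℕ) (ι : Type*) (n : ℕ) : Type _ :=
  (Fin d → ℝ) × (ι → lowOrder d n → ℝ)

section Jets

variable {d : ℕ} {ι : Type*}

/-- The variables `(x, y)` of a jet. -/
def Jet.base (z : Jet d ι) : Base d ι := (z.1, fun i => z.2 i 0)

/-- The variables `(x, y)` of a jet of order `n`. -/
def FiniteJet.base {n : ℕ} (w : FiniteJet d ι n) : Base d ι :=
  (w.1, fun i => w.2 i ⟨0, zero_mem_lowOrder d n⟩)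

/-- Forget all derivatives of order greater than `n`. -/
def Jet.trunc (n : ℕ) (z : Jet d ι) : FiniteJet d ι n := (z.1, fun i J => z.2 i J)

/-- `F` is a local function over the set `Ω` of variables `(x, y)`: a smooth function of `x`, `y`
and the derivatives of `y` up to some finite order. -/
def IsLocalFunction [Fintype ι] (Ω : Set (Base d ι)) (F : Jet d ι → ℝ) : Prop :=
  ∃ (n : ℕ) (f : FiniteJet d ι n → ℝ), ContDiffOn ℝ ∞ f {w | FiniteJet.base w ∈ Ω} ∧
    ∀ z : Jet d ι, Jet.base z ∈ Ω → F z = f (Jet.trunc n z)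

/-- The total derivative `d_μ F = ∂F/∂x^μ + ∑_{i,J} y^i_{J+μ} ∂F/∂y^i_J`, that is, the derivative
of `F` along the vector with `x`-component `e_μ` and `y^i_J`-component `y^i_{J+μ}`. -/
def totalDeriv (μ : Fin d) (F : Jet d ι → ℝ) : Jet d ι → ℝ := fun z =>
  lineDeriv ℝ F z (Pi.single μ 1, fun i J => z.2 i (J + MultiIndex.single μ))

/-- The iterated total derivative `D_J = (d_0)^{j_0} ⋯ (d_{d-1})^{j_{d-1}}`. -/
def iterTotalDeriv (J : MultiIndex d) (F : Jet d ι → ℝ) : Jet d ι → ℝ :=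
  (List.finRange d).foldr (fun μ G => (totalDeriv μ)^[J μ] G) F

/-- An infinitesimal generator `X = ξ^μ(x,y) ∂/∂x^μ + η^i(x,y) ∂/∂y^i` of point
transformations. -/
structure Generator (d : ℕ) (ι : Type*) where
  /-- the coefficients `ξ^μ` -/
  xi : Base d ι → Fin d → ℝ
  /-- the coefficients `η^i` -/
  eta : Base d ι → ι → ℝ

/-- The coefficients of `X` are smooth over `Ω`. -/
def Generator.SmoothOn [Fintype ι] (X : Generator d ι) (Ω : Set (Base d ι)) : Prop :=
  ContDiffOn ℝ ∞ X.xi Ω ∧ ContDiffOn ℝ ∞ X.eta Ω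

/-- The characteristic `Q^i = η^i - ξ^μ y^i_{,μ}`. -/
def Generator.characteristic (X : Generator d ι) (i : ι) : Jet d ι → ℝ := fun z =>
  X.eta z.base i - ∑ μ, X.xi z.base μ * z.2 i (MultiIndex.single μ)

/-- The components of the prolonged vector field `pr X` at a jet: `ξ^μ` along `x^μ` and
`η^i_J = D_J Q^i + ξ^μ y^i_{J+μ}` along `y^i_J`. -/
def Generator.prolongVector (X : Generator d ι) (z : Jet d ι) : Jet d ι :=
  (X.xi z.base, fun i J => iterTotalDeriv J (X.characteristic i) z
    + ∑ μ, X.xi z.base μ * z.2 i (J + MultiIndex.single μ))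

/-- The action of the prolongation `pr X = X + ∑_{|J| ≥ 1} η^i_J ∂/∂y^i_J` on a function. -/
def Generator.pr (X : Generator d ι) (F : Jet d ι → ℝ) : Jet d ι → ℝ := fun z =>
  lineDeriv ℝ F z (X.prolongVector z)

/-- The infinitesimal variation `pr X (L) + L d_μ ξ^μ` of the Lagrangian `L`. -/
def Generator.variation (X : Generator d ι) (L : Jet d ι → ℝ) : Jet d ι → ℝ := fun z =>
  X.pr L z + L z * ∑ μ, totalDeriv μ (fun z' => X.xi z'.base μ) z

/-- `X` generates, over `Ω`, a variational Lie point symmetry of `L`: the variation of `L` is a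
total divergence `d_μ β^μ` of local functions `β^μ`. -/
def Generator.IsVariationalSymmetry [Fintype ι] (X : Generator d ι) (Ω : Set (Base d ι))
    (L : Jet d ι → ℝ) : Prop :=
  X.SmoothOn Ω ∧ ∃ β : Fin d → Jet d ι → ℝ, (∀ μ, IsLocalFunction Ω (β μ)) ∧
    ∀ z : Jet d ι, z.base ∈ Ω → X.variation L z = ∑ μ, totalDeriv μ (β μ) z

/-- `X` generates, over `Ω`, a strict variational Lie point symmetry of `L`: the variation of `L`
vanishes. -/
def Generator.IsStrictVariationalSymmetry [Fintype ι] (X : Generator d ι) (Ω : Set (Base d ι))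
    (L : Jet d ι → ℝ) : Prop :=
  X.SmoothOn Ω ∧ ∀ z : Jet d ι, z.base ∈ Ω → X.variation L z = 0

/-- `X` generates, over `Ω`, a divergence symmetry of `L`: a variational symmetry for which one
cannot choose `β = 0`. -/
def Generator.IsDivergenceSymmetry [Fintype ι] (X : Generator d ι) (Ω : Set (Base d ι))
    (L : Jet d ι → ℝ) : Prop :=
  X.IsVariationalSymmetry Ω L ∧ ¬ X.IsStrictVariationalSymmetry Ω L

end Jets

/-! The Lagrangian with `N` Higgs doublets and `K` real gauge singlets. -/

/-- Indices of the real scalar fields: `Sum.inl (n, c)`, with `c = 0, 1, 2, 3`, are the four real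
components of the `n`-th doublet, and `Sum.inr m` is the `m`-th singlet. -/
abbrev Scalar (N K : ℕ) : Type := (Fin N × Fin 4) ⊕ Fin K

/-- Indices of the gauge fields: `Sum.inl (a, μ)` is `W^a_μ` and `Sum.inr μ` is `B_μ`. -/
abbrev Gauge (d : ℕ) : Type := (Fin 3 × Fin d) ⊕ Fin d

/-- Indices of all dependent variables. -/
abbrev Field (N K d : ℕ) : Type := Scalar N K ⊕ Gauge d

/-- The parameters of the theory: the gauge couplings `g` and `g'`, the hypercharge `Y` of the
doublets, and the potential `V`, a real polynomial in the real scalar fields. -/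
structure Parameters (N K : ℕ) where
  /-- the coupling `g` -/
  g : ℝ
  /-- the coupling `g'` -/
  gPrime : ℝ
  /-- the hypercharge `Y` -/
  Y : ℝ
  /-- the potential `V(Φ, s)` -/
  V : MvPolynomial (Scalar N K) ℝ

/-- The diagonal entries of the Minkowski metric, of signature `(+, -, …, -)`. -/
def metric {d : ℕ} (μ : Fin d) : ℝ := if (μ : ℕ) = 0 then 1 else -1

/-- The Pauli matrices `σ^1, σ^2, σ^3`. -/
def pauli : Fin 3 → Matrix (Fin 2) (Fin 2) ℂ :=
  ![!![0, 1; 1, 0], !![0, -Complex.I; Complex.I, 0], !![1, 0; 0, -1]]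

/-- The totally antisymmetric symbol `ε^{abc}` with `ε^{123} = 1`. -/
def epsilon (a b c : Fin 3) : ℝ :=
  (((b : ℕ) : ℝ) - ((a : ℕ) : ℝ)) * (((c : ℕ) : ℝ) - ((a : ℕ) : ℝ))
    * (((c : ℕ) : ℝ) - ((b : ℕ) : ℝ)) / 2

/-- The `n`-th doublet `(φ_1 + i φ_2, φ_3 + i φ_4) / √2` built from its real components. -/
def doublet {N K : ℕ} (φ : Scalar N K → ℝ) (n : Fin N) : Fin 2 → ℂ :=
  (((1 / √2 : ℝ)) : ℂ) •
    ![(φ (Sum.inl (n, 0)) : ℂ) + Complex.I * (φ (Sum.inl (n, 1)) : ℂ),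
      (φ (Sum.inl (n, 2)) : ℂ) + Complex.I * (φ (Sum.inl (n, 3)) : ℂ)]

section Lagrangian

variable {N K d : ℕ}

/-- The values of the scalar fields. -/
def scalars (z : Jet d (Field N K d)) (s : Scalar N K) : ℝ := z.2 (Sum.inl s) 0

/-- The derivatives `∂_μ` of the scalar fields. -/
def dScalars (z : Jet d (Field N K d)) (μ : Fin d) (s : Scalar N K) : ℝ :=
  z.2 (Sum.inl s) (MultiIndex.single μ)

/-- The value of `W^a_μ`. -/
def W (z : Jet d (Field N K d)) (a : Fin 3) (μ : Fin d) : ℝ := z.2 (Sum.inr (Sum.inl (a, μ))) 0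

/-- The derivative `∂_μ W^a_ν`. -/
def dW (z : Jet d (Field N K d)) (μ : Fin d) (a : Fin 3) (ν : Fin d) : ℝ :=
  z.2 (Sum.inr (Sum.inl (a, ν))) (MultiIndex.single μ)

/-- The value of `B_μ`. -/
def B (z : Jet d (Field N K d)) (μ : Fin d) : ℝ := z.2 (Sum.inr (Sum.inr μ)) 0

/-- The derivative `∂_μ B_ν`. -/
def dB (z : Jet d (Field N K d)) (μ ν : Fin d) : ℝ :=
  z.2 (Sum.inr (Sum.inr ν)) (MultiIndex.single μ)

/-- The covariant derivative
`D_μ Φ_n = ∂_μ Φ_n + i g (σ^a / 2) W^a_μ Φ_n + i g' Y B_μ Φ_n`. -/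
def covDeriv (p : Parameters N K) (z : Jet d (Field N K d)) (μ : Fin d) (n : Fin N) :
    Fin 2 → ℂ :=
  doublet (dScalars z μ) n
    + (Complex.I * (p.g : ℂ)) •
        ∑ a, ((W z a μ : ℂ) / 2) • (pauli a *ᵥ doublet (scalars z) n)
    + (Complex.I * (p.gPrime : ℂ) * (p.Y : ℂ) * (B z μ : ℂ)) • doublet (scalars z) n

/-- The field strength `W^a_{μν} = ∂_μ W^a_ν - ∂_ν W^a_μ + g ε^{abc} W^b_μ W^c_ν`. -/
def WField (p : Parameters N K) (z : Jet d (Field N K d)) (a : Fin 3) (μ ν : Fin d) : ℝ :=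
  dW z μ a ν - dW z ν a μ + p.g * ∑ b, ∑ c, epsilon a b c * W z b μ * W z c ν

/-- The field strength `B_{μν} = ∂_μ B_ν - ∂_ν B_μ`. -/
def BField (z : Jet d (Field N K d)) (μ ν : Fin d) : ℝ := dB z μ ν - dB z ν μ

/-- The kinetic terms `T_GB` of the gauge bosons. -/
def gaugeKinetic (p : Parameters N K) (z : Jet d (Field N K d)) : ℝ :=
  -∑ μ, ∑ ν, ((1 / 4) * ∑ a, WField p z a μ ν * (metric μ * metric ν * WField p z a μ ν)
    + (1 / 4) * (BField z μ ν * (metric μ * metric ν * BField z μ ν)))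

/-- The Lagrangian `L_d`. The number `(D_μ Φ_n)^† (D_μ Φ_n)` is real, so taking the real part
loses nothing. -/
def lagrangian (p : Parameters N K) (d : ℕ) (z : Jet d (Field N K d)) : ℝ :=
  ∑ μ, (∑ n, metric μ * (star (covDeriv p z μ n) ⬝ᵥ covDeriv p z μ n).re
      + ∑ m : Fin K, (1 / 2) *
          (dScalars z μ (Sum.inr m) * (metric μ * dScalars z μ (Sum.inr m))))
    - MvPolynomial.eval (scalars z) p.V + gaugeKinetic p z

/-- The scalar generator `η^i(φ) ∂/∂φ_i` in `d` spacetime dimensions: spacetime variables and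
gauge fields are not transformed, and the coefficients are functions of the scalars alone. -/
def scalarGenerator (d : ℕ) (η : (Scalar N K → ℝ) → Scalar N K → ℝ) :
    Generator d (Field N K d) where
  xi := fun _ _ => 0
  eta := fun q => Sum.elim (η (fun s => q.2 (Sum.inl s))) (fun _ => 0)

/-- The set of `(x, y)` whose scalar fields take values in `U`. -/
def overScalars (d : ℕ) (U : Set (Scalar N K → ℝ)) : Set (Base d (Field N K d)) :=
  {q | (fun s => q.2 (Sum.inl s)) ∈ U}

/-- The scalar variational Lie point symmetries of `L_d`, over the set `U` of scalar field
values. -/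
def scalarVariationalSymmetries (p : Parameters N K) (d : ℕ) (U : Set (Scalar N K → ℝ)) :
    Set ((Scalar N K → ℝ) → Scalar N K → ℝ) :=
  {η | (scalarGenerator d η).IsVariationalSymmetry (overScalars d U) (lagrangian p d)}

/-- The scalar strict variational Lie point symmetries of `L_d`. -/
def scalarStrictVariationalSymmetries (p : Parameters N K) (d : ℕ)
    (U : Set (Scalar N K → ℝ)) : Set ((Scalar N K → ℝ) → Scalar N K → ℝ) :=
  {η | (scalarGenerator d η).IsStrictVariationalSymmetry (overScalars d U) (lagrangian p d)}

/-- The scalar divergence symmetries of `L_d`. -/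
def scalarDivergenceSymmetries (p : Parameters N K) (d : ℕ) (U : Set (Scalar N K → ℝ)) :
    Set ((Scalar N K → ℝ) → Scalar N K → ℝ) :=
  {η | (scalarGenerator d η).IsDivergenceSymmetry (overScalars d U) (lagrangian p d)}

end Lagrangian

end NHDM

end

/-!
For a scalar generator `η`, the prolongation sees only the values and the first derivatives of the
scalars, and the gauge kinetic terms drop out. Hence (`variation_scalarGenerator`)
`pr X (L_d) = ∑_μ g_{μμ} k(φ, ∂_μ φ, A_μ) - c(φ)`, where the kinetic variation `k` (quadratic in
`(∂_μ φ, A_μ)`) and `c = ∑_s η^s ∂V/∂φ_s` do not depend on `d`. Both kinds of symmetry are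
characterized by `k` and `c` alone, so they cannot depend on `d`:

* `X` is variational if and only if `k = 0` and `dc = 0` on `U` (`isVariationalSymmetry_iff`);
* `X` is strict if and only if `k = 0` and `c = 0` on `U` (`isStrictVariationalSymmetry_iff`).

If `k = 0` and `dc = 0`, then `-c = d_0 (-x^0 c)` is a total divergence, whatever the topology of
`U`. Conversely, the integral of a total divergence over spacetime does not change when the fields
are varied in a compact set (`integral_divergence_sub_eq_zero`). The constant configuration
`φ = φ₀`, `A = 0` is compared with `φ = φ₀ + ε χ w`, `A_μ = ε ∂_μ χ a`, where `χ` is a product of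
equal bump functions of the coordinates, whose jet is explicit. This gives
`∫ (ε² (∂_μ χ ∂^μ χ) k(φ₀ + ε χ w, w, a) - (c(φ₀ + ε χ w) - c(φ₀))) = 0` for all small `ε`.
The first order in `ε` is `dc(φ₀) w ∫ χ = 0`. So `c` is locally constant, and the second order is
`k(φ₀, w, a) ∫ ∂_μ χ ∂^μ χ = 0`. The last integral is a positive multiple of the trace
`1 - (d - 1)` of the metric, which is nonzero unless `d = 2`.
-/

noncomputable section

namespace NHDM

/-! ### Total derivatives along prolonged fields -/

section Jets

variable {d : ℕ} {ι : Type*}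

theorem iterTotalDeriv_zero (F : Jet d ι → ℝ) : iterTotalDeriv 0 F = F := by
  unfold iterTotalDeriv
  induction List.finRange d with
  | nil => rfl
  | cons ν l => simp

theorem iterTotalDeriv_single (μ : Fin d) (F : Jet d ι → ℝ) :
    iterTotalDeriv (MultiIndex.single μ) F = totalDeriv μ F := by
  have key : ∀ l : List (Fin d), l.Nodup →
      l.foldr (fun ν G => (totalDeriv ν)^[MultiIndex.single μ ν] G) F
        = if μ ∈ l then totalDeriv μ F else F := by
    intro l
    induction l with
    | nil => simp
    | cons ν l ih =>
      intro h
      rw [List.nodup_cons] at h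
      rw [List.foldr_cons, ih h.2]
      by_cases hν : ν = μ
      · subst hν
        simp [h.1]
      · have hμ : μ ≠ ν := fun h => hν h.symm
        simp [hν, hμ]
  unfold iterTotalDeriv
  rw [key _ (List.nodup_finRange d)]
  simp

theorem totalDeriv_const (μ : Fin d) (c : ℝ) :
    totalDeriv μ (fun _ : Jet d ι => c) = fun _ => 0 := by
  funext z
  simp [totalDeriv, lineDeriv]

theorem iterTotalDeriv_zero_fun (J : MultiIndex d) :
    iterTotalDeriv J (fun _ : Jet d ι => (0 : ℝ)) = fun _ => 0 := by
  unfold iterTotalDeriv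
  induction List.finRange d with
  | nil => rfl
  | cons ν l ih =>
    rw [List.foldr_cons, ih]
    exact Function.iterate_fixed (totalDeriv_const ν 0) _

theorem continuous_finiteJet_base (n : ℕ) :
    Continuous (FiniteJet.base : FiniteJet d ι n → Base d ι) := by
  unfold FiniteJet.base
  fun_prop

variable [Fintype ι]

/-- A local function is differentiable along every direction of the infinite jet space, and its
derivative is computed in a finite jet space. -/
theorem hasLineDerivAt_of_trunc {n : ℕ} {Ω : Set (Base d ι)} (hΩ : IsOpen Ω)
    {f : FiniteJet d ι n → ℝ} (hf : ContDiffOn ℝ ∞ f {w | FiniteJet.base w ∈ Ω})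
    {F : Jet d ι → ℝ} (hF : ∀ z : Jet d ι, Jet.base z ∈ Ω → F z = f (Jet.trunc n z))
    {z : Jet d ι} (hz : z.base ∈ Ω) (v : Jet d ι) :
    HasLineDerivAt ℝ F (fderiv ℝ f (Jet.trunc n z) (Jet.trunc n v)) z v := by
  have hO : IsOpen {w : FiniteJet d ι n | FiniteJet.base w ∈ Ω} :=
    hΩ.preimage (continuous_finiteJet_base n)
  have hd : HasFDerivAt f (fderiv ℝ f (Jet.trunc n z)) (Jet.trunc n z) :=
    ((hf.contDiffAt (hO.mem_nhds hz)).differentiableAt (by simp)).hasFDerivAt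
  refine HasDerivAt.congr_of_eventuallyEq (hd.hasLineDerivAt (Jet.trunc n v)) ?_
  have hc : Continuous fun t : ℝ => Jet.trunc n z + t • Jet.trunc n v := by fun_prop
  have hmem : ∀ᶠ t : ℝ in nhds 0,
      Jet.trunc n z + t • Jet.trunc n v ∈ {w : FiniteJet d ι n | FiniteJet.base w ∈ Ω} :=
    hc.continuousAt.eventually_mem (hO.mem_nhds (by rw [zero_smul, add_zero]; exact hz))
  filter_upwards [hmem] with t ht
  exact hF _ ht

/-- `j` is the infinite jet of a smooth field configuration `x ↦ y(x)`: its components `y^i_J`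
are smooth functions of `x` with `∂_μ y^i_J = y^i_{J+μ}`. -/
structure IsHolonomic (j : (Fin d → ℝ) → Jet d ι) : Prop where
  fst : ∀ x, (j x).1 = x
  smooth : ∀ i J, ContDiff ℝ ∞ fun x => (j x).2 i J
  fderiv_single : ∀ i J μ x, fderiv ℝ (fun x' => (j x').2 i J) x (Pi.single μ 1)
    = (j x).2 i (J + MultiIndex.single μ)

theorem IsHolonomic.contDiff_trunc {j : (Fin d → ℝ) → Jet d ι} (hj : IsHolonomic j) (n : ℕ) :
    ContDiff ℝ ∞ fun x => Jet.trunc n (j x) := by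
  unfold Jet.trunc
  refine ContDiff.prodMk ?_ ?_
  · simp only [hj.fst]
    exact contDiff_id
  · exact contDiff_pi.2 fun i => contDiff_pi.2 fun J => hj.smooth i J

theorem IsHolonomic.fderiv_trunc {j : (Fin d → ℝ) → Jet d ι} (hj : IsHolonomic j) (n : ℕ)
    (x : Fin d → ℝ) (μ : Fin d) :
    fderiv ℝ (fun x => Jet.trunc n (j x)) x (Pi.single μ 1)
      = Jet.trunc n (Pi.single μ 1, fun i J => (j x).2 i (J + MultiIndex.single μ)) := by
  have hs : ∀ i J, DifferentiableAt ℝ (fun x => (j x).2 i J) x := fun i J =>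
    (hj.smooth i J).differentiable (by simp) x
  have h2 : HasFDerivAt (fun x => Jet.trunc n (j x))
      ((ContinuousLinearMap.id ℝ (Fin d → ℝ)).prod (ContinuousLinearMap.pi fun i =>
        ContinuousLinearMap.pi fun J : lowOrder d n => fderiv ℝ (fun x => (j x).2 i J) x)) x := by
    unfold Jet.trunc
    refine HasFDerivAt.prodMk ?_ ?_
    · simp only [hj.fst]
      exact hasFDerivAt_id x
    · exact hasFDerivAt_pi.2 fun i => hasFDerivAt_pi.2 fun J => (hs i J).hasFDerivAt
  rw [h2.fderiv]
  simp [Jet.trunc, hj.fderiv_single]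

/-- Along the jet of a field configuration a local function is smooth in `x`, and its partial
derivatives are the values of its total derivatives. -/
theorem IsLocalFunction.comp_holonomic {Ω : Set (Base d ι)} (hΩ : IsOpen Ω) {F : Jet d ι → ℝ}
    (hF : IsLocalFunction Ω F) {j : (Fin d → ℝ) → Jet d ι} (hj : IsHolonomic j)
    (hjΩ : ∀ x, (j x).base ∈ Ω) :
    ContDiff ℝ ∞ (fun x => F (j x)) ∧
      ∀ x μ, fderiv ℝ (fun x => F (j x)) x (Pi.single μ 1) = totalDeriv μ F (j x) := by
  obtain ⟨n, f, hf, hFf⟩ := hF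
  have hO : IsOpen {w : FiniteJet d ι n | FiniteJet.base w ∈ Ω} :=
    hΩ.preimage (continuous_finiteJet_base n)
  have he : (fun x => F (j x)) = f ∘ fun x => Jet.trunc n (j x) :=
    funext fun x => hFf _ (hjΩ x)
  refine ⟨?_, fun x μ => ?_⟩
  · rw [he]
    exact hf.comp_contDiff (hj.contDiff_trunc n) hjΩ
  · have hd : DifferentiableAt ℝ f (Jet.trunc n (j x)) :=
      (hf.contDiffAt (hO.mem_nhds (hjΩ x))).differentiableAt (by simp)
    rw [he, fderiv_comp x hd ((hj.contDiff_trunc n).differentiable (by simp) x),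
      ContinuousLinearMap.comp_apply, hj.fderiv_trunc]
    exact (hasLineDerivAt_of_trunc hΩ hf hFf (hjΩ x) _).lineDeriv.symm

/-- The integral of a partial derivative of a compactly supported function vanishes. -/
theorem integral_fderiv_apply_eq_zero {G : (Fin d → ℝ) → ℝ} (hG : ContDiff ℝ ∞ G)
    (hc : HasCompactSupport G) (v : Fin d → ℝ) : ∫ x, fderiv ℝ G x v = 0 := by
  have h1 : MeasureTheory.Integrable fun x => fderiv ℝ G x v :=
    ((hG.continuous_fderiv (by simp)).clm_apply
      continuous_const).integrable_of_hasCompactSupport (hc.fderiv_apply ℝ v)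
  have h := integral_mul_fderiv_eq_neg_fderiv_mul_of_integrable (μ := MeasureTheory.volume)
    (f := fun _ : Fin d → ℝ => (1 : ℝ)) (g := G) (v := v) (by simp) (by simpa using h1)
    (by simpa using hG.continuous.integrable_of_hasCompactSupport hc)
    (fun x _ => differentiableAt_const _) (fun x _ => hG.differentiable (by simp) x)
  simpa using h

/-- The action of a total divergence does not change when the fields are varied inside a compact
set. -/
theorem integral_divergence_sub_eq_zero {Ω : Set (Base d ι)} (hΩ : IsOpen Ω)
    {β : Fin d → Jet d ι → ℝ} (hβ : ∀ μ, IsLocalFunction Ω (β μ))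
    {j j₀ : (Fin d → ℝ) → Jet d ι} (hj : IsHolonomic j) (hj₀ : IsHolonomic j₀)
    (hjΩ : ∀ x, (j x).base ∈ Ω) (hj₀Ω : ∀ x, (j₀ x).base ∈ Ω)
    {C : Set (Fin d → ℝ)} (hC : IsCompact C) (hjC : ∀ x, x ∉ C → j x = j₀ x) :
    ∫ x, (∑ μ, totalDeriv μ (β μ) (j x) - ∑ μ, totalDeriv μ (β μ) (j₀ x)) = 0 := by
  have hs : ∀ μ, ContDiff ℝ ∞ fun x => β μ (j x) - β μ (j₀ x) := fun μ =>
    ((hβ μ).comp_holonomic hΩ hj hjΩ).1.sub ((hβ μ).comp_holonomic hΩ hj₀ hj₀Ω).1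
  have hcs : ∀ μ, HasCompactSupport fun x => β μ (j x) - β μ (j₀ x) := fun μ =>
    HasCompactSupport.intro hC fun x hx => by rw [hjC x hx, sub_self]
  have he : ∀ x, ∑ μ, totalDeriv μ (β μ) (j x) - ∑ μ, totalDeriv μ (β μ) (j₀ x)
      = ∑ μ, fderiv ℝ (fun x => β μ (j x) - β μ (j₀ x)) x (Pi.single μ 1) := by
    intro x
    rw [← Finset.sum_sub_distrib]
    refine Finset.sum_congr rfl fun μ _ => ?_
    have h1 := (hβ μ).comp_holonomic hΩ hj hjΩ
    have h2 := (hβ μ).comp_holonomic hΩ hj₀ hj₀Ω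
    rw [fderiv_fun_sub (h1.1.differentiable (by simp) x) (h2.1.differentiable (by simp) x),
      sub_apply, h1.2, h2.2]
  simp only [he]
  rw [MeasureTheory.integral_finsetSum]
  · exact Finset.sum_eq_zero fun μ _ => integral_fderiv_apply_eq_zero (hs μ) (hcs μ) _
  · intro μ _
    exact (((hs μ).continuous_fderiv (by simp)).clm_apply
      continuous_const).integrable_of_hasCompactSupport ((hcs μ).fderiv_apply ℝ _)

end Jets

/-! ### The variation of the Lagrangian under a scalar generator -/

section Variation

variable {N K d : ℕ}

theorem doublet_add_smul (φ ψ : Scalar N K → ℝ) (t : ℝ) (n : Fin N) :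
    doublet (φ + t • ψ) n = doublet φ n + (t : ℂ) • doublet ψ n := by
  ext i
  fin_cases i <;> simp [doublet] <;> ring

theorem doublet_smul (t : ℝ) (ψ : Scalar N K → ℝ) (n : Fin N) :
    doublet (t • ψ) n = (t : ℂ) • doublet ψ n := by
  ext i
  fin_cases i <;> simp [doublet] <;> ring

/-- The covariant derivative of the `n`-th doublet as a function of the values `a` of `W_μ`, `b`
of `B_μ`, `φ` of the scalars, and `v` of their derivatives `∂_μ`. -/
def covDerivAt (p : Parameters N K) (a : Fin 3 → ℝ) (b : ℝ) (φ v : Scalar N K → ℝ) (n : Fin N) :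
    Fin 2 → ℂ :=
  doublet v n
    + (Complex.I * (p.g : ℂ)) • ∑ c, ((a c : ℂ) / 2) • (pauli c *ᵥ doublet φ n)
    + (Complex.I * (p.gPrime : ℂ) * (p.Y : ℂ) * (b : ℂ)) • doublet φ n

theorem covDerivAt_add_smul (p : Parameters N K) (a : Fin 3 → ℝ) (b : ℝ)
    (φ v φ' v' : Scalar N K → ℝ) (t : ℝ) (n : Fin N) :
    covDerivAt p a b (φ + t • φ') (v + t • v') n
      = covDerivAt p a b φ v n + (t : ℂ) • covDerivAt p a b φ' v' n := by
  simp only [covDerivAt, doublet_add_smul, Matrix.mulVec_add, Matrix.mulVec_smul, smul_add,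
    Finset.sum_add_distrib, Finset.smul_sum]
  simp only [smul_comm (t : ℂ)]
  abel

/-- The covariant derivative is jointly homogeneous in `∂_μ φ` and the gauge fields. -/
theorem covDerivAt_smul (p : Parameters N K) (a : Fin 3 → ℝ) (b : ℝ) (φ v : Scalar N K → ℝ)
    (t : ℝ) (n : Fin N) :
    covDerivAt p (t • a) (t * b) φ (t • v) n = (t : ℂ) • covDerivAt p a b φ v n := by
  ext i
  simp only [covDerivAt, doublet_smul, Fin.sum_univ_three, Pi.add_apply, Pi.smul_apply,
    smul_eq_mul, Complex.ofReal_mul]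
  ring

/-- The first-order change, in the direction `(φ', v')`, of the kinetic term
`(D_μ Φ_n)^† (D_μ Φ_n) + ½ (∂_μ s_m)²` of one spacetime direction `μ`. -/
def kineticForm (p : Parameters N K) (a : Fin 3 → ℝ) (b : ℝ) (φ v φ' v' : Scalar N K → ℝ) : ℝ :=
  ∑ n, 2 * (star (covDerivAt p a b φ v n) ⬝ᵥ covDerivAt p a b φ' v' n).re
    + ∑ m : Fin K, v (Sum.inr m) * v' (Sum.inr m)

theorem kineticForm_smul (p : Parameters N K) (a : Fin 3 → ℝ) (b : ℝ)
    (φ v φ' v' : Scalar N K → ℝ) (t : ℝ) :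
    kineticForm p (t • a) (t * b) φ (t • v) φ' (t • v') = t ^ 2 * kineticForm p a b φ v φ' v' := by
  simp only [kineticForm, covDerivAt_smul, mul_add, Finset.mul_sum]
  congr 1
  · refine Finset.sum_congr rfl fun n _ => ?_
    simp [dotProduct, Fin.sum_univ_two]
    ring
  · refine Finset.sum_congr rfl fun m _ => ?_
    simp
    ring

theorem re_star_dotProduct_add_smul (u w : Fin 2 → ℂ) (t : ℝ) :
    (star (u + (t : ℂ) • w) ⬝ᵥ (u + (t : ℂ) • w)).re
      = (star u ⬝ᵥ u).re + t * (2 * (star u ⬝ᵥ w).re) + t ^ 2 * (star w ⬝ᵥ w).re := by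
  simp [dotProduct, Fin.sum_univ_two]
  ring

theorem contDiff_potential (p : Parameters N K) :
    ContDiff ℝ ∞ fun φ : Scalar N K → ℝ => MvPolynomial.eval φ p.V :=
  (AnalyticOnNhd.eval_mvPolynomial p.V).contDiff

theorem hasDerivAt_quadratic (q₀ q₁ q₂ : ℝ) :
    HasDerivAt (fun t : ℝ => q₀ + t * q₁ + t ^ 2 * q₂) q₁ 0 := by
  have h := (((hasDerivAt_id (0 : ℝ)).mul_const q₁).const_add q₀).add
    (((hasDerivAt_id (0 : ℝ)).pow 2).mul_const q₂)
  exact h.congr_deriv (by simp)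

theorem scalars_add_smul (z v : Jet d (Field N K d)) (t : ℝ) :
    scalars (z + t • v) = scalars z + t • scalars v := rfl

theorem dScalars_add_smul (z v : Jet d (Field N K d)) (t : ℝ) (μ : Fin d) :
    dScalars (z + t • v) μ = dScalars z μ + t • dScalars v μ := rfl

/-- The derivative of the Lagrangian in a direction that does not move the gauge fields. -/
theorem hasLineDerivAt_lagrangian (p : Parameters N K) (z v : Jet d (Field N K d))
    (hv : ∀ i J, v.2 (Sum.inr i) J = 0) :
    HasLineDerivAt ℝ (lagrangian p d)
      (∑ μ, metric μ * kineticForm p (fun c => W z c μ) (B z μ) (scalars z) (dScalars z μ)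
          (scalars v) (dScalars v μ)
        - fderiv ℝ (fun φ => MvPolynomial.eval φ p.V) (scalars z) (scalars v)) z v := by
  have hW : ∀ t : ℝ, W (z + t • v) = W z := by
    intro t; funext c μ; simp [W, hv]
  have hB : ∀ t : ℝ, B (z + t • v) = B z := by
    intro t; funext μ; simp [B, hv]
  have hdW : ∀ t : ℝ, dW (z + t • v) = dW z := by
    intro t; funext μ c ν; simp [dW, hv]
  have hdB : ∀ t : ℝ, dB (z + t • v) = dB z := by
    intro t; funext μ ν; simp [dB, hv]
  have hG : ∀ t : ℝ, gaugeKinetic p (z + t • v) = gaugeKinetic p z := by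
    intro t
    simp only [gaugeKinetic, WField, BField, hW, hdW, hdB]
  have hC : ∀ (t : ℝ) μ n, covDeriv p (z + t • v) μ n
      = covDerivAt p (fun c => W z c μ) (B z μ) (scalars z) (dScalars z μ) n
        + (t : ℂ) • covDerivAt p (fun c => W z c μ) (B z μ) (scalars v) (dScalars v μ) n := by
    intro t μ n
    rw [← covDerivAt_add_smul]
    simp only [covDeriv, covDerivAt, hW, hB, scalars_add_smul, dScalars_add_smul]
  have hV : HasDerivAt (fun t : ℝ => MvPolynomial.eval (scalars z + t • scalars v) p.V)
      (fderiv ℝ (fun φ => MvPolynomial.eval φ p.V) (scalars z) (scalars v)) 0 :=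
    ((contDiff_potential p).differentiable (by simp) _).hasFDerivAt.hasLineDerivAt _
  unfold HasLineDerivAt
  simp only [lagrangian, hG, hC, re_star_dotProduct_add_smul, scalars_add_smul,
    dScalars_add_smul]
  refine ((HasDerivAt.fun_sum fun μ _ => ?_).sub hV).add_const _
  rw [kineticForm, mul_add, Finset.mul_sum, Finset.mul_sum]
  refine (HasDerivAt.fun_sum fun n _ => ?_).add (HasDerivAt.fun_sum fun m _ => ?_)
  · exact (hasDerivAt_quadratic _ _ _).const_mul _
  · have h := hasDerivAt_quadratic
      (1 / 2 * metric μ * dScalars z μ (Sum.inr m) ^ 2)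
      (metric μ * (dScalars z μ (Sum.inr m) * dScalars v μ (Sum.inr m)))
      (1 / 2 * metric μ * dScalars v μ (Sum.inr m) ^ 2)
    refine h.congr_of_eventuallyEq (Filter.Eventually.of_forall fun t => ?_)
    simp only [Pi.add_apply, Pi.smul_apply, smul_eq_mul]
    ring

/-- The part `2 Re (D_μ Φ)^† δ(D_μ Φ) + ∂_μ s δ(∂_μ s)` of the variation that comes from one
spacetime direction, at scalars `φ`, derivatives `v`, and gauge fields `a`, `b`. -/
def kineticVariation (p : Parameters N K) (η : (Scalar N K → ℝ) → Scalar N K → ℝ)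
    (φ v : Scalar N K → ℝ) (a : Fin 3 → ℝ) (b : ℝ) : ℝ :=
  kineticForm p a b φ v (η φ) (fderiv ℝ η φ v)

/-- The variation `∑_s η^s ∂V/∂φ_s` of the potential. -/
def potentialVariation (p : Parameters N K) (η : (Scalar N K → ℝ) → Scalar N K → ℝ)
    (φ : Scalar N K → ℝ) : ℝ :=
  fderiv ℝ (fun φ => MvPolynomial.eval φ p.V) φ (η φ)

theorem isOpen_overScalars {U : Set (Scalar N K → ℝ)} (hU : IsOpen U) (d : ℕ) :
    IsOpen (overScalars d U) :=
  hU.preimage (by fun_prop)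

theorem smoothOn_scalarGenerator {U : Set (Scalar N K → ℝ)}
    (η : (Scalar N K → ℝ) → Scalar N K → ℝ) :
    (scalarGenerator d η).SmoothOn (overScalars d U) ↔ ContDiffOn ℝ ∞ η U := by
  constructor
  · rintro ⟨-, h⟩
    -- restrict `η` to `x = 0` and vanishing gauge fields
    let s : (Scalar N K → ℝ) → Base d (Field N K d) := fun φ => (0, Sum.elim φ fun _ => 0)
    have hs : ContDiff ℝ ∞ s := by
      refine contDiff_const.prodMk (contDiff_pi.2 fun i => ?_)
      cases i with
      | inl i => exact contDiff_apply ℝ ℝ i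
      | inr i => exact contDiff_const
    have h' := h.comp (f := s) (s := U) hs.contDiffOn (fun φ hφ => hφ)
    exact contDiffOn_pi.2 fun i => contDiffOn_pi.1 h' (Sum.inl i)
  · intro h
    refine ⟨contDiffOn_const, contDiffOn_pi.2 fun i => ?_⟩
    cases i with
    | inl i =>
      exact (contDiffOn_pi.1 h i).comp (t := U) (s := overScalars d U)
        (f := fun q : Base d (Field N K d) => fun s => q.2 (Sum.inl s))
        (ContDiff.contDiffOn (by fun_prop)) (fun q hq => hq)
    | inr i => exact contDiffOn_const

theorem totalDeriv_comp_scalars {U : Set (Scalar N K → ℝ)} (hU : IsOpen U)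
    {f : (Scalar N K → ℝ) → ℝ} (hf : DifferentiableOn ℝ f U) {z : Jet d (Field N K d)}
    (hz : scalars z ∈ U) (μ : Fin d) :
    totalDeriv μ (fun z => f (scalars z)) z = fderiv ℝ f (scalars z) (dScalars z μ) := by
  have h := ((hf.differentiableAt (hU.mem_nhds hz)).hasFDerivAt).hasLineDerivAt (dScalars z μ)
  have e : dScalars z μ = fun s => z.2 (Sum.inl s) (0 + MultiIndex.single μ) := by
    funext s; rw [zero_add]; rfl
  rw [e] at h ⊢
  exact HasDerivAt.deriv h

/-- The variation of the Lagrangian is a sum of copies of one kinetic variation, one for each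
spacetime direction, and the variation of the potential; the gauge kinetic terms drop out. -/
theorem variation_scalarGenerator (p : Parameters N K) {U : Set (Scalar N K → ℝ)} (hU : IsOpen U)
    {η : (Scalar N K → ℝ) → Scalar N K → ℝ} (hη : ContDiffOn ℝ ∞ η U)
    {z : Jet d (Field N K d)} (hz : scalars z ∈ U) :
    (scalarGenerator d η).variation (lagrangian p d) z
      = ∑ μ, metric μ * kineticVariation p η (scalars z) (dScalars z μ)
          (fun c => W z c μ) (B z μ)
        - potentialVariation p η (scalars z) := by
  have hchar : ∀ i, (scalarGenerator d η).characteristic i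
      = fun z => (Sum.elim (η (scalars z)) (fun _ => 0) : Field N K d → ℝ) i := by
    intro i; funext z
    simp [Generator.characteristic, scalarGenerator]
    rfl
  set v := (scalarGenerator d η).prolongVector z with hv
  have hv2 : ∀ i J, v.2 i J = iterTotalDeriv J ((scalarGenerator d η).characteristic i) z := by
    intro i J
    simp [hv, Generator.prolongVector, scalarGenerator]
  have hg : ∀ i J, v.2 (Sum.inr i) J = 0 := by
    intro i J
    rw [hv2, hchar]
    exact congrFun (iterTotalDeriv_zero_fun J) z
  have h0 : scalars v = η (scalars z) := by
    funext s
    rw [scalars, hv2, iterTotalDeriv_zero, hchar]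
    rfl
  have h1 : ∀ μ, dScalars v μ = fderiv ℝ η (scalars z) (dScalars z μ) := by
    intro μ; funext s
    have hs : DifferentiableOn ℝ (fun φ => η φ s) U :=
      (contDiffOn_pi.1 hη s).differentiableOn (by simp)
    rw [dScalars, hv2, iterTotalDeriv_single, hchar]
    have hd : DifferentiableAt ℝ η (scalars z) :=
      (hη.differentiableOn (by simp)).differentiableAt (hU.mem_nhds hz)
    exact (totalDeriv_comp_scalars hU hs hz μ).trans
      (congrArg (· (dScalars z μ)) (fderiv_apply hd s))
  have hdiv : ∀ μ, totalDeriv μ (fun z' : Jet d (Field N K d) =>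
      (scalarGenerator d η).xi z'.base μ) z = 0 :=
    fun μ => congrFun (totalDeriv_const μ 0) z
  simp only [Generator.variation, hdiv, Finset.sum_const_zero, mul_zero, add_zero, Generator.pr]
  rw [← hv, (hasLineDerivAt_lagrangian p z v hg).lineDeriv]
  simp only [h0, h1, kineticVariation, potentialVariation]

end Variation

/-! ### Jets of product bump functions -/

section Bump

variable {d : ℕ} {ι : Type*}

/-- The partial derivative `∂^J` of the product function `x ↦ ∏_μ h(x^μ)`. -/
def prodDeriv (h : ℝ → ℝ) (J : MultiIndex d) (x : Fin d → ℝ) : ℝ := ∏ μ, deriv^[J μ] h (x μ)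

theorem contDiff_prodDeriv {h : ℝ → ℝ} (hh : ContDiff ℝ ∞ h) (J : MultiIndex d) :
    ContDiff ℝ ∞ (prodDeriv h J) :=
  contDiff_prod fun μ _ => (hh.iterate_deriv (J μ)).comp (contDiff_apply ℝ ℝ μ)

/-- Differentiating the product raises one index, so the jet of `∏_μ h(x^μ)` is explicit. -/
theorem fderiv_prodDeriv_single {h : ℝ → ℝ} (hh : ContDiff ℝ ∞ h) (J : MultiIndex d) (μ : Fin d)
    (x : Fin d → ℝ) :
    fderiv ℝ (prodDeriv h J) x (Pi.single μ 1) = prodDeriv h (J + MultiIndex.single μ) x := by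
  have h1 : HasDerivAt (fun t : ℝ => ∏ ν, deriv^[J ν] h ((x + t • (Pi.single μ 1 : Fin d → ℝ)) ν))
      (prodDeriv h (J + MultiIndex.single μ) x) 0 := by
    have hμ : ∀ t : ℝ, ∏ ν, deriv^[J ν] h ((x + t • (Pi.single μ 1 : Fin d → ℝ)) ν)
        = deriv^[J μ] h (x μ + t) * ∏ ν ∈ Finset.univ.erase μ, deriv^[J ν] h (x ν) := by
      intro t
      rw [← Finset.mul_prod_erase _ _ (Finset.mem_univ μ)]
      congr 1
      · simp
      · refine Finset.prod_congr rfl fun ν hν => ?_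
        simp [Finset.ne_of_mem_erase hν]
    have hμ' : prodDeriv h (J + MultiIndex.single μ) x
        = deriv (deriv^[J μ] h) (x μ) * ∏ ν ∈ Finset.univ.erase μ, deriv^[J ν] h (x ν) := by
      rw [prodDeriv, ← Finset.mul_prod_erase _ _ (Finset.mem_univ μ)]
      congr 1
      · simp [Function.iterate_succ_apply']
      · refine Finset.prod_congr rfl fun ν hν => ?_
        simp [Finset.ne_of_mem_erase hν]
    simp only [hμ]
    rw [hμ']
    refine HasDerivAt.mul_const ?_ _
    have hd : HasDerivAt (deriv^[J μ] h) (deriv (deriv^[J μ] h) (x μ)) (x μ + 0) := by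
      rw [add_zero]
      exact ((hh.iterate_deriv (J μ)).differentiable (by simp) _).hasDerivAt
    exact hd.comp_const_add (x μ) 0
  have h2 := ((contDiff_prodDeriv hh J).differentiable (by simp) x).hasFDerivAt.hasLineDerivAt
    (Pi.single μ 1)
  exact HasDerivAt.unique h2 h1

theorem prodDeriv_eq_zero {h : ℝ → ℝ} (J : MultiIndex d) {x : Fin d → ℝ}
    (hx : x ∉ Set.pi Set.univ fun _ : Fin d => tsupport h) : prodDeriv h J x = 0 := by
  simp only [Set.mem_pi, Set.mem_univ, true_implies, not_forall] at hx
  obtain ⟨μ, hμ⟩ := hx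
  refine Finset.prod_eq_zero (Finset.mem_univ μ) ?_
  have hsub : ∀ k : ℕ, tsupport (deriv^[k] h) ⊆ tsupport h := by
    intro k
    induction k with
    | zero => exact subset_rfl
    | succ k ih =>
      rw [Function.iterate_succ_apply']
      exact (closure_minimal support_deriv_subset (isClosed_tsupport _)).trans ih
  exact image_eq_zero_of_notMem_tsupport fun hk => hμ (hsub _ hk)

theorem hasCompactSupport_prodDeriv {h : ℝ → ℝ} (hc : HasCompactSupport h) (J : MultiIndex d) :
    HasCompactSupport (prodDeriv h J) :=
  HasCompactSupport.intro (isCompact_univ_pi fun _ => hc) fun _ hx => prodDeriv_eq_zero J hx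

/-- The jet of the configuration `y^i(x) = y₀^i + b^i ∂^{M_i} χ(x)` with `χ(x) = ∏_μ h(x^μ)`. -/
def bumpJet (h : ℝ → ℝ) (y₀ b : ι → ℝ) (M : ι → MultiIndex d) (x : Fin d → ℝ) : Jet d ι :=
  (x, fun i J => (if J = 0 then y₀ i else 0) + b i * prodDeriv h (J + M i) x)

theorem isHolonomic_bumpJet {h : ℝ → ℝ} (hh : ContDiff ℝ ∞ h) (y₀ b : ι → ℝ)
    (M : ι → MultiIndex d) : IsHolonomic (bumpJet h y₀ b M) where
  fst _ := rfl
  smooth i J := contDiff_const.add (contDiff_const.mul (contDiff_prodDeriv hh _))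
  fderiv_single i J μ x := by
    have hJ : J + MultiIndex.single μ ≠ 0 := fun h => by simpa using congrFun h μ
    have hd : DifferentiableAt ℝ (prodDeriv h (J + M i)) x :=
      (contDiff_prodDeriv hh _).differentiable (by simp) x
    simp only [bumpJet, if_neg hJ, zero_add]
    rw [fderiv_const_add, fderiv_const_mul hd, smul_apply, fderiv_prodDeriv_single hh,
      smul_eq_mul, add_right_comm]

/-- A fixed nonnegative smooth bump function of one variable. -/
def bump : ℝ → ℝ := (default : ContDiffBump (0 : ℝ))

theorem contDiff_bump : ContDiff ℝ ∞ bump := ContDiffBump.contDiff _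

theorem hasCompactSupport_bump : HasCompactSupport bump := ContDiffBump.hasCompactSupport _

theorem integral_bump_pos : 0 < ∫ t, bump t := ContDiffBump.integral_pos _

theorem integral_iterate_deriv_bump_sq_pos (k : ℕ) (hk : ∃ t, deriv^[k] bump t ≠ 0) :
    0 < ∫ t, (deriv^[k] bump t) ^ 2 := by
  obtain ⟨t, ht⟩ := hk
  have hc : HasCompactSupport (deriv^[k] bump) := by
    clear ht
    induction k with
    | zero => exact hasCompactSupport_bump
    | succ k ih => rw [Function.iterate_succ_apply']; exact ih.deriv
  refine Continuous.integral_pos_of_hasCompactSupport_nonneg_nonzero (x := t)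
    ((contDiff_bump.iterate_deriv k).continuous.pow 2) ?_ (fun _ => sq_nonneg _)
    (pow_ne_zero 2 ht)
  simp only [pow_two]
  exact hc.mul_right

theorem integral_bump_sq_pos : 0 < ∫ t, bump t ^ 2 :=
  integral_iterate_deriv_bump_sq_pos 0 ⟨0, by
    have h : bump 0 = 1 := ContDiffBump.one_of_mem_closedBall _
      (Metric.mem_closedBall_self (ContDiffBump.rIn_pos _).le)
    simp [h]⟩

theorem integral_deriv_bump_sq_pos : 0 < ∫ t, deriv bump t ^ 2 := by
  refine integral_iterate_deriv_bump_sq_pos 1 ?_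
  by_contra! h
  have h0 : bump 0 = 1 := ContDiffBump.one_of_mem_closedBall _
    (Metric.mem_closedBall_self (ContDiffBump.rIn_pos _).le)
  obtain ⟨x, hx⟩ : ∃ x, bump x = 0 := by
    by_contra! hne
    have hu : tsupport bump = Set.univ := Set.eq_univ_of_forall fun x => subset_tsupport _ (hne x)
    exact noncompact_univ ℝ (hu ▸ hasCompactSupport_bump)
  have := is_const_of_deriv_eq_zero (contDiff_bump.differentiable (by simp)) h 0 x
  rw [h0, hx] at this
  exact one_ne_zero this

theorem integral_prodDeriv_bump_ne_zero : ∫ x : Fin d → ℝ, prodDeriv bump 0 x ≠ 0 := by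
  simp only [prodDeriv, Pi.zero_apply, Function.iterate_zero, id_eq]
  rw [MeasureTheory.integral_fintype_prod_volume_eq_prod (f := fun _ : Fin d => bump)]
  exact Finset.prod_ne_zero_iff.2 fun _ _ => integral_bump_pos.ne'

theorem integral_prodDeriv_bump_single_sq (μ : Fin d) :
    ∫ x : Fin d → ℝ, prodDeriv bump (MultiIndex.single μ) x ^ 2
      = (∫ t, deriv bump t ^ 2) / (∫ t, bump t ^ 2) * (∫ t, bump t ^ 2) ^ d := by
  simp only [prodDeriv, ← Finset.prod_pow]
  rw [MeasureTheory.integral_fintype_prod_volume_eq_prod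
    (f := fun ν : Fin d => fun t => (deriv^[MultiIndex.single μ ν] bump t) ^ 2)]
  have h : ∀ ν : Fin d, ∫ t, (deriv^[MultiIndex.single μ ν] bump t) ^ 2
      = (if ν = μ then (∫ t, deriv bump t ^ 2) / (∫ t, bump t ^ 2) else 1)
        * ∫ t, bump t ^ 2 := by
    intro ν
    by_cases hν : ν = μ
    · subst hν
      simp [div_mul_cancel₀ _ integral_bump_sq_pos.ne']
    · simp [hν]
  simp only [h, Finset.prod_mul_distrib]
  simp

/-- The gradient square `∂_μ χ ∂^μ χ` of the product bump function. -/
def gradSq (x : Fin d → ℝ) : ℝ := ∑ μ, metric μ * prodDeriv bump (MultiIndex.single μ) x ^ 2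

theorem continuous_gradSq : Continuous (gradSq (d := d)) :=
  continuous_finsetSum _ fun _ _ =>
    continuous_const.mul ((contDiff_prodDeriv contDiff_bump _).continuous.pow 2)

theorem hasCompactSupport_gradSq : HasCompactSupport (gradSq (d := d)) :=
  HasCompactSupport.intro (isCompact_univ_pi fun _ => hasCompactSupport_bump) fun _ hx =>
    Finset.sum_eq_zero fun _ _ => by simp [prodDeriv_eq_zero _ hx]

/-- All coordinates contribute equally to the action of `χ`, so the Minkowski signs add up to the
trace of the metric. -/
theorem integral_gradSq_ne_zero (hd : ∑ μ : Fin d, metric μ ≠ 0) :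
    ∫ x : Fin d → ℝ, gradSq x ≠ 0 := by
  simp only [gradSq]
  rw [MeasureTheory.integral_finsetSum]
  · simp only [MeasureTheory.integral_const_mul, integral_prodDeriv_bump_single_sq]
    rw [← Finset.sum_mul]
    have h0 := integral_bump_sq_pos
    have h1 := integral_deriv_bump_sq_pos
    exact mul_ne_zero hd (by positivity)
  · intro μ _
    refine (Continuous.integrable_of_hasCompactSupport
      ((contDiff_prodDeriv contDiff_bump _).continuous.pow 2) ?_).const_mul _
    simp only [pow_two]
    exact (hasCompactSupport_prodDeriv hasCompactSupport_bump _).mul_right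

end Bump

/-! ### Small amplitudes -/

section SmallAmplitude

open Filter Topology MeasureTheory

variable {X : Type*} {χ M : X → ℝ} {C : ℝ}

theorem eventually_forall_mul (hχ : ∀ x, |χ x| ≤ C) {P : ℝ → Prop} (hP : ∀ᶠ s in 𝓝 0, P s) :
    ∀ᶠ ε : ℝ in 𝓝 0, ∀ x, P (ε * χ x) := by
  obtain ⟨δ, hδ, hball⟩ := Metric.eventually_nhds_iff.1 hP
  have ht : Tendsto (fun ε : ℝ => |ε| * C) (𝓝 0) (𝓝 0) := by
    have : Continuous fun ε : ℝ => |ε| * C := by fun_prop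
    simpa using this.tendsto 0
  filter_upwards [ht.eventually (gt_mem_nhds hδ)] with ε hε x
  refine hball ?_
  rw [dist_zero_right, Real.norm_eq_abs, abs_mul]
  exact (mul_le_mul_of_nonneg_left (hχ x) (abs_nonneg ε)).trans_lt hε

variable [TopologicalSpace X]

/-- For small `ε`, `f (ε χ)` is continuous if `f` is continuous near `0`. -/
theorem eventually_continuous_comp_mul (hχ : ∀ x, |χ x| ≤ C) (hχc : Continuous χ) {f : ℝ → ℝ}
    (hf : ∀ᶠ s in 𝓝 0, ContinuousAt f s) :
    ∀ᶠ ε : ℝ in 𝓝 0, Continuous fun x => f (ε * χ x) := by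
  filter_upwards [eventually_forall_mul hχ hf] with ε hε
  exact continuous_iff_continuousAt.2 fun x =>
    ContinuousAt.comp (f := fun x => ε * χ x) (hε x) (by fun_prop)

variable [MeasurableSpace X] [OpensMeasurableSpace X] {m : Measure X}

/-- The part of first order in `ε` of an identity
`∫ (ε² M k(ε χ) - (g(ε χ) - g(0))) = 0`. -/
theorem deriv_mul_integral_eq_zero (hχ : ∀ x, |χ x| ≤ C) (hχc : Continuous χ)
    (hχi : Integrable χ m) (hMc : Continuous M) (hMi : Integrable M m) {k g : ℝ → ℝ} {g' : ℝ}
    (hk : ∀ᶠ s in 𝓝 0, ContinuousAt k s) (hgc : ∀ᶠ s in 𝓝 0, ContinuousAt g s)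
    (hg : HasDerivAt g g' 0)
    (H : ∀ᶠ ε : ℝ in 𝓝 0,
      ∫ x, (ε ^ 2 * (M x * k (ε * χ x)) - (g (ε * χ x) - g 0)) ∂m = 0) :
    g' * ∫ x, χ x ∂m = 0 := by
  obtain ⟨D, hD⟩ := hg.isBigO_sub.bound
  have hk1 : ∀ᶠ s in 𝓝 0, |k s| ≤ |k 0| + 1 :=
    (hk.self_of_nhds.abs.eventually_lt_const (lt_add_one _)).mono fun _ h => h.le
  have ht : Tendsto (fun ε : ℝ => ∫ x, (ε * (M x * k (ε * χ x))
      - ε⁻¹ * (g (ε * χ x) - g 0)) ∂m) (𝓝[≠] 0) (𝓝 (∫ x, -(g' * χ x) ∂m)) := by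
    refine tendsto_integral_filter_of_dominated_convergence
      (fun x => |M x| * (|k 0| + 1) + D * |χ x|) ?_ ?_ ?_ ?_
    · filter_upwards [nhdsWithin_le_nhds (eventually_continuous_comp_mul hχ hχc hk),
        nhdsWithin_le_nhds (eventually_continuous_comp_mul hχ hχc hgc)] with ε h1 h2
      exact ((continuous_const.mul (hMc.mul h1)).sub
        (continuous_const.mul (h2.sub continuous_const))).aestronglyMeasurable
    · have hε1 : ∀ᶠ ε : ℝ in 𝓝 0, |ε| ≤ 1 := by
        filter_upwards [Metric.closedBall_mem_nhds (0 : ℝ) one_pos] with ε hε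
        simpa using hε
      filter_upwards [nhdsWithin_le_nhds (eventually_forall_mul hχ hk1),
        nhdsWithin_le_nhds (eventually_forall_mul hχ hD), nhdsWithin_le_nhds hε1,
        self_mem_nhdsWithin] with ε h1 h2 h3 h4
      refine Eventually.of_forall fun x => ?_
      have h4' : |ε| ≠ 0 := abs_ne_zero.2 h4
      have h5 := h2 x
      rw [sub_zero, Real.norm_eq_abs, Real.norm_eq_abs, abs_mul] at h5
      rw [Real.norm_eq_abs]
      refine (abs_sub _ _).trans (add_le_add ?_ ?_)
      · rw [abs_mul, abs_mul]
        calc |ε| * (|M x| * |k (ε * χ x)|) ≤ 1 * (|M x| * (|k 0| + 1)) := by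
              gcongr
              exact h1 x
          _ = _ := one_mul _
      · rw [abs_mul, abs_inv]
        calc |ε|⁻¹ * |g (ε * χ x) - g 0| ≤ |ε|⁻¹ * (D * (|ε| * |χ x|)) := by gcongr
          _ = D * |χ x| := by field_simp
    · exact (hMi.abs.mul_const _).add (hχi.abs.const_mul _)
    · refine Eventually.of_forall fun x => ?_
      have h1 : Tendsto (fun ε : ℝ => ε * (M x * k (ε * χ x))) (𝓝[≠] 0) (𝓝 0) := by
        have hc : ContinuousAt (fun ε : ℝ => ε * (M x * k (ε * χ x))) 0 := by
          have : ContinuousAt (fun ε : ℝ => k (ε * χ x)) 0 :=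
            ContinuousAt.comp (f := fun ε : ℝ => ε * χ x)
              (by rw [zero_mul]; exact hk.self_of_nhds) (by fun_prop)
          exact continuousAt_id.mul (continuousAt_const.mul this)
        have := hc.tendsto
        rw [zero_mul] at this
        exact this.mono_left nhdsWithin_le_nhds
      have h2 : Tendsto (fun ε : ℝ => ε⁻¹ * (g (ε * χ x) - g 0)) (𝓝[≠] 0) (𝓝 (g' * χ x)) := by
        have hd : HasDerivAt (fun ε : ℝ => g (ε * χ x)) (g' * χ x) 0 := by
          have hg0 : HasDerivAt g g' (0 * χ x) := by rwa [zero_mul]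
          exact hg0.comp (0 : ℝ) (hasDerivAt_mul_const (χ x))
        simpa using hd.tendsto_slope_zero
      simpa using h1.sub h2
  have h0 : ∀ᶠ ε : ℝ in 𝓝[≠] 0, ∫ x, (ε * (M x * k (ε * χ x))
      - ε⁻¹ * (g (ε * χ x) - g 0)) ∂m = 0 := by
    filter_upwards [nhdsWithin_le_nhds H, self_mem_nhdsWithin] with ε hε hne
    have hne' : ε ≠ 0 := hne
    have : ∀ x, ε * (M x * k (ε * χ x)) - ε⁻¹ * (g (ε * χ x) - g 0)
        = ε⁻¹ * (ε ^ 2 * (M x * k (ε * χ x)) - (g (ε * χ x) - g 0)) := by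
      intro x; field_simp
    simp only [this]
    rw [integral_const_mul, hε, mul_zero]
  have h := tendsto_nhds_unique ht (tendsto_const_nhds.congr' (h0.mono fun _ h => h.symm))
  rwa [integral_neg, integral_const_mul, neg_eq_zero] at h

/-- The limit `ε → 0` of an identity `∫ M k(ε χ) = 0`: what remains at second order in `ε` once
`g` is locally constant. -/
theorem value_mul_integral_eq_zero (hχ : ∀ x, |χ x| ≤ C) (hχc : Continuous χ)
    (hMc : Continuous M) (hMi : Integrable M m) {k : ℝ → ℝ}
    (hk : ∀ᶠ s in 𝓝 0, ContinuousAt k s)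
    (H : ∀ᶠ ε : ℝ in 𝓝[≠] 0, ∫ x, M x * k (ε * χ x) ∂m = 0) :
    k 0 * ∫ x, M x ∂m = 0 := by
  have hk1 : ∀ᶠ s in 𝓝 0, |k s| ≤ |k 0| + 1 :=
    (hk.self_of_nhds.abs.eventually_lt_const (lt_add_one _)).mono fun _ h => h.le
  have ht : Tendsto (fun ε : ℝ => ∫ x, M x * k (ε * χ x) ∂m) (𝓝[≠] 0)
      (𝓝 (∫ x, M x * k 0 ∂m)) := by
    refine tendsto_integral_filter_of_dominated_convergence
      (fun x => |M x| * (|k 0| + 1)) ?_ ?_ ?_ ?_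
    · filter_upwards [nhdsWithin_le_nhds (eventually_continuous_comp_mul hχ hχc hk)] with ε h1
      exact (hMc.mul h1).aestronglyMeasurable
    · filter_upwards [nhdsWithin_le_nhds (eventually_forall_mul hχ hk1)] with ε h1
      refine Eventually.of_forall fun x => ?_
      rw [Real.norm_eq_abs, abs_mul]
      gcongr
      exact h1 x
    · exact hMi.abs.mul_const _
    · refine Eventually.of_forall fun x => ?_
      have hc : ContinuousAt (fun ε : ℝ => M x * k (ε * χ x)) 0 := by
        have : ContinuousAt (fun ε : ℝ => k (ε * χ x)) 0 :=
          ContinuousAt.comp (f := fun ε : ℝ => ε * χ x)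
            (by rw [zero_mul]; exact hk.self_of_nhds) (by fun_prop)
        exact continuousAt_const.mul this
      have := hc.tendsto
      rw [zero_mul] at this
      exact this.mono_left nhdsWithin_le_nhds
  have h := tendsto_nhds_unique ht (tendsto_const_nhds.congr' (H.mono fun _ h => h.symm))
  rwa [integral_mul_const, mul_comm] at h

end SmallAmplitude

/-! ### Characterization of the scalar symmetries -/

section Characterization

open Filter Topology MeasureTheory

variable {N K d : ℕ}

theorem continuous_doublet (n : Fin N) :
    Continuous fun φ : Scalar N K → ℝ => doublet φ n := by
  refine continuous_pi fun i => ?_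
  fin_cases i <;> simp [doublet] <;> fun_prop

theorem continuousOn_covDerivAt (p : Parameters N K) (a : Fin 3 → ℝ) (b : ℝ) (n : Fin N)
    {U : Set (Scalar N K → ℝ)} {f f' : (Scalar N K → ℝ) → Scalar N K → ℝ}
    (hf : ContinuousOn f U) (hf' : ContinuousOn f' U) :
    ContinuousOn (fun φ => covDerivAt p a b (f φ) (f' φ) n) U := by
  have h : Continuous fun q : (Fin 2 → ℂ) × (Fin 2 → ℂ) => q.2
      + (Complex.I * (p.g : ℂ)) • ∑ c, ((a c : ℂ) / 2) • (pauli c *ᵥ q.1)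
      + (Complex.I * (p.gPrime : ℂ) * (p.Y : ℂ) * (b : ℂ)) • q.1 := by fun_prop
  have h' := h.comp_continuousOn (((continuous_doublet n).comp_continuousOn hf).prodMk
    ((continuous_doublet n).comp_continuousOn hf'))
  simpa only [covDerivAt, Function.comp_def] using h'

theorem continuousOn_kineticVariation (p : Parameters N K) {U : Set (Scalar N K → ℝ)}
    (hU : IsOpen U) {η : (Scalar N K → ℝ) → Scalar N K → ℝ} (hη : ContDiffOn ℝ ∞ η U)
    (v : Scalar N K → ℝ) (a : Fin 3 → ℝ) (b : ℝ) :
    ContinuousOn (fun φ => kineticVariation p η φ v a b) U := by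
  have h1 : ContinuousOn (fun φ => fderiv ℝ η φ v) U :=
    (hη.continuousOn_fderiv_of_isOpen hU (by simp)).clm_apply continuousOn_const
  have h2 : Continuous fun q : (Fin 2 → ℂ) × (Fin 2 → ℂ) => 2 * (star q.1 ⬝ᵥ q.2).re := by
    fun_prop
  have h3 : ∀ n, ContinuousOn (fun φ => 2 * (star (covDerivAt p a b φ v n) ⬝ᵥ
      covDerivAt p a b (η φ) (fderiv ℝ η φ v) n).re) U := by
    intro n
    have h := h2.comp_continuousOn
      ((continuousOn_covDerivAt p a b n continuousOn_id (continuousOn_const (c := v))).prodMk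
        (continuousOn_covDerivAt p a b n hη.continuousOn h1))
    simpa only [Function.comp_def, id_eq] using h
  have h4 : ∀ i, ContinuousOn (fun φ => v i * fderiv ℝ η φ v i) U := fun i =>
    continuousOn_const.mul (continuousOn_pi.1 h1 i)
  simp only [kineticVariation, kineticForm]
  exact (continuousOn_finsetSum _ fun n _ => h3 n).add
    (continuousOn_finsetSum _ fun m _ => h4 (Sum.inr m))

theorem contDiffOn_potentialVariation (p : Parameters N K) {U : Set (Scalar N K → ℝ)}
    {η : (Scalar N K → ℝ) → Scalar N K → ℝ} (hη : ContDiffOn ℝ ∞ η U) :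
    ContDiffOn ℝ ∞ (potentialVariation p η) U :=
  (((contDiff_potential p).fderiv_right (m := ∞) (by simp)).contDiffOn).clm_apply hη

theorem kineticVariation_smul (p : Parameters N K) (η : (Scalar N K → ℝ) → Scalar N K → ℝ)
    (φ v : Scalar N K → ℝ) (a : Fin 3 → ℝ) (b t : ℝ) :
    kineticVariation p η φ (t • v) (t • a) (t * b) = t ^ 2 * kineticVariation p η φ v a b := by
  rw [kineticVariation, map_smul, kineticForm_smul, kineticVariation]

/-- The jet of the configuration with scalars `φ₀ + ε χ w` and gauge fields
`W^c_μ = ε ∂_μ χ a^c`, `B_μ = ε ∂_μ χ b`. -/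
def testJet (φ₀ w : Scalar N K → ℝ) (a : Fin 3 → ℝ) (b ε : ℝ) :
    (Fin d → ℝ) → Jet d (Field N K d) :=
  bumpJet bump (Sum.elim φ₀ fun _ => 0)
    (ε • Sum.elim w (Sum.elim (fun i => a i.1) fun _ => b))
    (Sum.elim (fun _ => 0) (Sum.elim (fun i => MultiIndex.single i.2) MultiIndex.single))

theorem scalars_testJet (φ₀ w : Scalar N K → ℝ) (a : Fin 3 → ℝ) (b ε : ℝ) (x : Fin d → ℝ) :
    scalars (testJet φ₀ w a b ε x) = φ₀ + (ε * prodDeriv bump 0 x) • w := by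
  funext s
  simp [scalars, testJet, bumpJet]
  ring

/-- The gauge fields of the test configuration are proportional to `∂_μ χ`, as are the derivatives
of its scalars, so every spacetime direction contributes the same kinetic variation. -/
theorem variation_testJet (p : Parameters N K) {U : Set (Scalar N K → ℝ)} (hU : IsOpen U)
    {η : (Scalar N K → ℝ) → Scalar N K → ℝ} (hη : ContDiffOn ℝ ∞ η U)
    (φ₀ w : Scalar N K → ℝ) (a : Fin 3 → ℝ) (b ε : ℝ) (x : Fin d → ℝ)
    (hx : φ₀ + (ε * prodDeriv bump 0 x) • w ∈ U) :
    (scalarGenerator d η).variation (lagrangian p d) (testJet φ₀ w a b ε x)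
      = ε ^ 2 * (gradSq x * kineticVariation p η (φ₀ + (ε * prodDeriv bump 0 x) • w) w a b)
        - potentialVariation p η (φ₀ + (ε * prodDeriv bump 0 x) • w) := by
  rw [← scalars_testJet φ₀ w a b] at hx
  have hs : ∀ μ : Fin d, (MultiIndex.single μ : MultiIndex d) ≠ 0 := fun μ h => by
    simpa using congrFun h μ
  have h1 : ∀ μ, dScalars (testJet φ₀ w a b ε x) μ
      = (ε * prodDeriv bump (MultiIndex.single μ) x) • w := by
    intro μ; funext s
    simp [dScalars, testJet, bumpJet]
    ring
  have h2 : ∀ μ, (fun c => W (testJet (N := N) (K := K) φ₀ w a b ε x) c μ)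
      = (ε * prodDeriv bump (MultiIndex.single μ) x) • a := by
    intro μ; funext c
    simp [W, testJet, bumpJet]
    ring
  have h3 : ∀ μ, B (testJet (N := N) (K := K) φ₀ w a b ε x) μ
      = ε * prodDeriv bump (MultiIndex.single μ) x * b := by
    intro μ
    simp [B, testJet, bumpJet]
    ring
  rw [variation_scalarGenerator p hU hη hx]
  simp only [h1, h2, h3, kineticVariation_smul, scalars_testJet, gradSq, Finset.sum_mul,
    Finset.mul_sum]
  congr 1
  refine Finset.sum_congr rfl fun μ _ => ?_
  ring

/-- Comparison of the actions of a test configuration and a constant configuration. -/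
theorem integral_variation_eq_zero (p : Parameters N K) {U : Set (Scalar N K → ℝ)} (hU : IsOpen U)
    {η : (Scalar N K → ℝ) → Scalar N K → ℝ}
    (h : (scalarGenerator d η).IsVariationalSymmetry (overScalars d U) (lagrangian p d))
    {φ₀ : Scalar N K → ℝ} (hφ₀ : φ₀ ∈ U) (w : Scalar N K → ℝ) (a : Fin 3 → ℝ) (b ε : ℝ)
    (hε : ∀ x : Fin d → ℝ, φ₀ + (ε * prodDeriv bump 0 x) • w ∈ U) :
    ∫ x : Fin d → ℝ,
      (ε ^ 2 * (gradSq x * kineticVariation p η (φ₀ + (ε * prodDeriv bump 0 x) • w) w a b)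
        - (potentialVariation p η (φ₀ + (ε * prodDeriv bump 0 x) • w)
          - potentialVariation p η (φ₀ + (0 : ℝ) • w))) = 0 := by
  obtain ⟨hη, β, hβ, hvar⟩ := h
  rw [smoothOn_scalarGenerator] at hη
  have h0 : ∀ x : Fin d → ℝ, φ₀ + (0 * prodDeriv bump 0 x) • w ∈ U := fun x => by simpa using hφ₀
  have hbase : ∀ t, (∀ x : Fin d → ℝ, φ₀ + (t * prodDeriv bump 0 x) • w ∈ U) →
      ∀ x, (testJet (d := d) φ₀ w a b t x).base ∈ overScalars d U := by
    intro t ht x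
    have := ht x
    rwa [← scalars_testJet φ₀ w a b] at this
  have key := integral_divergence_sub_eq_zero (isOpen_overScalars hU d) hβ
    (isHolonomic_bumpJet contDiff_bump _ _ _) (isHolonomic_bumpJet contDiff_bump _ _ _)
    (hbase ε hε) (hbase 0 h0) (isCompact_univ_pi fun _ => hasCompactSupport_bump)
    (fun x hx => by simp [bumpJet, prodDeriv_eq_zero _ hx])
  refine Eq.trans (integral_congr_ae (Eventually.of_forall fun x => ?_)) key
  refine Eq.trans ?_ (congrArg₂ (· - ·) (hvar _ (hbase ε hε x)) (hvar _ (hbase 0 h0 x)))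
  change _ = (scalarGenerator d η).variation (lagrangian p d) (testJet φ₀ w a b ε x)
    - (scalarGenerator d η).variation (lagrangian p d) (testJet φ₀ w a b 0 x)
  rw [variation_testJet p hU hη _ _ _ _ _ _ (hε x), variation_testJet p hU hη _ _ _ _ _ _ (h0 x)]
  simp only [zero_mul]
  ring

/-- The conditions on `η` that a variational symmetry satisfies, in terms that do not refer to the
dimension of spacetime: the kinetic variation vanishes and the variation of the potential is
locally constant. -/
theorem isVariationalSymmetry_iff (hd : ∑ μ : Fin d, metric μ ≠ 0) (p : Parameters N K)
    {U : Set (Scalar N K → ℝ)} (hU : IsOpen U) (η : (Scalar N K → ℝ) → Scalar N K → ℝ) :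
    (scalarGenerator d η).IsVariationalSymmetry (overScalars d U) (lagrangian p d) ↔
      ContDiffOn ℝ ∞ η U ∧ (∀ φ ∈ U, ∀ v a b, kineticVariation p η φ v a b = 0) ∧
        ∀ φ ∈ U, HasFDerivAt (potentialVariation p η) (0 : (Scalar N K → ℝ) →L[ℝ] ℝ) φ := by
  constructor
  · intro h
    have hη : ContDiffOn ℝ ∞ η U := (smoothOn_scalarGenerator η).1 h.1
    have hχc : Continuous (prodDeriv bump (0 : MultiIndex d)) :=
      (contDiff_prodDeriv contDiff_bump 0).continuous
    have hχs : HasCompactSupport (prodDeriv bump (0 : MultiIndex d)) :=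
      hasCompactSupport_prodDeriv hasCompactSupport_bump 0
    obtain ⟨C, hC⟩ := hχs.exists_bound_of_continuous hχc
    have hχi := hχc.integrable_of_hasCompactSupport (μ := volume) hχs
    have hMi := (continuous_gradSq (d := d)).integrable_of_hasCompactSupport (μ := volume)
      hasCompactSupport_gradSq
    -- small multiples of `w` do not leave `U`
    have hline : ∀ φ ∈ U, ∀ w : Scalar N K → ℝ, ∀ᶠ s : ℝ in 𝓝 0, φ + s • w ∈ U := by
      intro φ hφ w
      have : Continuous fun s : ℝ => φ + s • w := by fun_prop
      exact this.continuousAt.eventually_mem (hU.mem_nhds (by simpa using hφ))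
    have hcont : ∀ f : (Scalar N K → ℝ) → ℝ, ContinuousOn f U → ∀ φ ∈ U, ∀ w : Scalar N K → ℝ,
        ∀ᶠ s : ℝ in 𝓝 0, ContinuousAt (fun s : ℝ => f (φ + s • w)) s := by
      intro f hf φ hφ w
      filter_upwards [hline φ hφ w] with s hs
      exact ContinuousAt.comp (f := fun s : ℝ => φ + s • w) (hf.continuousAt (hU.mem_nhds hs))
        (by fun_prop)
    have hpot := contDiffOn_potentialVariation p hη
    have hint : ∀ φ ∈ U, ∀ w a b, ∀ᶠ ε : ℝ in 𝓝 0, ∫ x : Fin d → ℝ,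
        (ε ^ 2 * (gradSq x * kineticVariation p η (φ + (ε * prodDeriv bump 0 x) • w) w a b)
          - (potentialVariation p η (φ + (ε * prodDeriv bump 0 x) • w)
            - potentialVariation p η (φ + (0 : ℝ) • w))) = 0 := by
      intro φ hφ w a b
      filter_upwards [eventually_forall_mul hC (hline φ hφ w)] with ε hε
      exact integral_variation_eq_zero p hU h hφ w a b ε hε
    have hderiv : ∀ φ ∈ U,
        HasFDerivAt (potentialVariation p η) (0 : (Scalar N K → ℝ) →L[ℝ] ℝ) φ := by
      intro φ hφ
      have hf := ((hpot.contDiffAt (hU.mem_nhds hφ)).differentiableAt (by simp)).hasFDerivAt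
      suffices h0 : fderiv ℝ (potentialVariation p η) φ = 0 by rwa [h0] at hf
      ext w
      have hzero := deriv_mul_integral_eq_zero hC hχc hχi continuous_gradSq hMi
        (hcont _ (continuousOn_kineticVariation p hU hη w 0 0) φ hφ w)
        (hcont _ hpot.continuousOn φ hφ w) (hf.hasLineDerivAt w) (hint φ hφ w 0 0)
      exact (mul_eq_zero.1 hzero).resolve_right integral_prodDeriv_bump_ne_zero
    refine ⟨hη, fun φ hφ v a b => ?_, hderiv⟩
    -- the potential no longer contributes on a ball around `φ`
    obtain ⟨r, hr, hball⟩ := Metric.isOpen_iff.1 hU φ hφ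
    have hconst : ∀ ψ ∈ Metric.ball φ r, potentialVariation p η ψ = potentialVariation p η φ := by
      intro ψ hψ
      refine (convex_ball φ r).is_const_of_fderivWithin_eq_zero (𝕜 := ℝ)
        (fun ξ hξ => (hderiv ξ (hball hξ)).differentiableAt.differentiableWithinAt)
        (fun ξ hξ => ?_) hψ (Metric.mem_ball_self hr)
      rw [fderivWithin_of_isOpen Metric.isOpen_ball hξ]
      exact (hderiv ξ (hball hξ)).fderiv
    have hnear : ∀ᶠ s : ℝ in 𝓝 0, φ + s • v ∈ Metric.ball φ r := by
      have : Continuous fun s : ℝ => φ + s • v := by fun_prop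
      exact this.continuousAt.eventually_mem
        (Metric.isOpen_ball.mem_nhds (by simpa using hr))
    have hzero := value_mul_integral_eq_zero (m := volume) hC hχc continuous_gradSq hMi
      (hcont _ (continuousOn_kineticVariation p hU hη v a b) φ hφ v) (by
        filter_upwards [nhdsWithin_le_nhds (hint φ hφ v a b),
          nhdsWithin_le_nhds (eventually_forall_mul hC hnear), self_mem_nhdsWithin] with ε h1 h2 h3
        simp only [hconst _ (h2 _), zero_smul, add_zero, sub_self, sub_zero] at h1
        rw [integral_const_mul] at h1
        exact (mul_eq_zero.1 h1).resolve_left (pow_ne_zero 2 h3))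
    have hk := (mul_eq_zero.1 hzero).resolve_right (integral_gradSq_ne_zero hd)
    simpa using hk
  · rintro ⟨hη, hkin, hpot⟩
    obtain ⟨μ₀, -, -⟩ := Finset.exists_ne_zero_of_sum_ne_zero hd
    -- `-c = d_μ₀ (-x^μ₀ c)` because `dc = 0`
    refine ⟨(smoothOn_scalarGenerator η).2 hη, Pi.single μ₀ fun z =>
      -(z.1 μ₀ * potentialVariation p η (scalars z)), fun μ => ?_, fun z hz => ?_⟩
    · by_cases hμ : μ = μ₀
      · subst hμ
        rw [Pi.single_eq_same]
        refine ⟨0, fun w => -(w.1 μ * potentialVariation p η fun s => w.base.2 (Sum.inl s)),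
          ?_, fun z _ => rfl⟩
        refine (ContDiffOn.mul (ContDiff.contDiffOn (by fun_prop)) ?_).neg
        refine (contDiffOn_potentialVariation p hη).comp
          (f := fun w : FiniteJet d (Field N K d) 0 => fun s => w.base.2 (Sum.inl s))
          (ContDiff.contDiffOn ?_) (fun w hw => hw)
        simp only [FiniteJet.base]
        fun_prop
      · rw [Pi.single_eq_of_ne hμ]
        exact ⟨0, 0, contDiffOn_const, fun _ _ => rfl⟩
    · have hz' : scalars z ∈ U := hz
      rw [variation_scalarGenerator p hU hη hz']
      simp only [hkin _ hz', mul_zero, Finset.sum_const_zero, zero_sub]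
      rw [Finset.sum_eq_single μ₀]
      · rw [Pi.single_eq_same]
        refine (HasDerivAt.deriv ?_).symm
        have h1 : HasDerivAt (fun t : ℝ => z.1 μ₀ + t * 1) 1 0 := by
          simpa using ((hasDerivAt_id (0 : ℝ)).mul_const 1).const_add (z.1 μ₀)
        have h2 := (hpot _ hz').hasLineDerivAt
          (fun s => z.2 (Sum.inl s) (0 + MultiIndex.single μ₀))
        have h3 := (h1.mul h2).neg
        refine (h3.congr_deriv (by simp)).congr_of_eventuallyEq
          (Eventually.of_forall fun t => ?_)
        simp only [Pi.neg_apply, Pi.mul_apply, Prod.fst_add, Prod.smul_fst, Pi.add_apply,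
          Pi.smul_apply, Pi.single_eq_same, smul_eq_mul]
        rfl
      · intro μ _ hμ
        rw [Pi.single_eq_of_ne hμ]
        exact congrFun (totalDeriv_const μ 0) z
      · simp

theorem isStrictVariationalSymmetry_iff (hd : ∑ μ : Fin d, metric μ ≠ 0) (p : Parameters N K)
    {U : Set (Scalar N K → ℝ)} (hU : IsOpen U) (η : (Scalar N K → ℝ) → Scalar N K → ℝ) :
    (scalarGenerator d η).IsStrictVariationalSymmetry (overScalars d U) (lagrangian p d) ↔
      ContDiffOn ℝ ∞ η U ∧ (∀ φ ∈ U, ∀ v a b, kineticVariation p η φ v a b = 0) ∧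
        ∀ φ ∈ U, potentialVariation p η φ = 0 := by
  constructor
  · rintro ⟨hs, hvar⟩
    -- a strict symmetry is variational with `β = 0`
    have h : (scalarGenerator d η).IsVariationalSymmetry (overScalars d U) (lagrangian p d) := by
      refine ⟨hs, fun _ _ => 0, fun _ => ⟨0, 0, contDiffOn_const, fun _ _ => rfl⟩, fun z hz => ?_⟩
      simp [hvar z hz, totalDeriv_const]
    obtain ⟨hη, hkin, -⟩ := (isVariationalSymmetry_iff hd p hU η).1 h
    refine ⟨hη, hkin, fun φ hφ => ?_⟩
    let z : Jet d (Field N K d) := (0, fun i _ => Sum.elim φ (fun _ => 0) i)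
    have hz : scalars z ∈ U := hφ
    have h0 := hvar z hz
    rw [variation_scalarGenerator p hU hη hz] at h0
    simp only [hkin _ hz, mul_zero, Finset.sum_const_zero, zero_sub, neg_eq_zero] at h0
    exact h0
  · rintro ⟨hη, hkin, hpot⟩
    refine ⟨(smoothOn_scalarGenerator η).2 hη, fun z hz => ?_⟩
    have hz' : scalars z ∈ U := hz
    rw [variation_scalarGenerator p hU hη hz', hpot _ hz']
    simp [hkin _ hz']

theorem sum_metric (n : ℕ) : ∑ μ : Fin (n + 1), metric μ = 1 - n := by
  simp [metric, Fin.sum_univ_succ, sub_eq_add_neg]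

end Characterization

end NHDM

end

theorem corollary1 (N K : ℕ) (p : NHDM.Parameters N K) (U : Set (NHDM.Scalar N K → ℝ))
    (hU : IsOpen U) :
    NHDM.scalarVariationalSymmetries p 4 U = NHDM.scalarVariationalSymmetries p 1 U ∧
      NHDM.scalarStrictVariationalSymmetries p 4 U =
        NHDM.scalarStrictVariationalSymmetries p 1 U ∧
      NHDM.scalarDivergenceSymmetries p 4 U = NHDM.scalarDivergenceSymmetries p 1 U := by
  -- the traces are `-2` and `1`
  have h4 : ∑ μ : Fin 4, NHDM.metric μ ≠ 0 := by
    rw [NHDM.sum_metric]; norm_num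
  have h1 : ∑ μ : Fin 1, NHDM.metric μ ≠ 0 := by
    rw [NHDM.sum_metric]; norm_num
  have hv := fun η => (NHDM.isVariationalSymmetry_iff h4 p hU η).trans
    (NHDM.isVariationalSymmetry_iff h1 p hU η).symm
  have hs := fun η => (NHDM.isStrictVariationalSymmetry_iff h4 p hU η).trans
    (NHDM.isStrictVariationalSymmetry_iff h1 p hU η).symm
  exact ⟨Set.ext hv, Set.ext hs, Set.ext fun η => and_congr (hv η) (not_congr (hs η))⟩
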